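/- For a set $\mathcal H$ of affine hyperplanes in $\mathbb R^d$, let $\Delta(\mathcal H)$ be the set system on $\mathcal H$ whose members are the sets $\{h\in\mathcal H : h\cap s\neq\emptyset\}$, where $s$ ranges over all open $d$-dimensional simplices in $\mathbb R^d$. A set system $\mathcal R$ shatters a set $Y$ if every subset of $Y$ is of the form $Y\cap R$ with $R\in\mathcal R$, and its VC-dimension $\mathrm{VCdim}(\mathcal R)$ is the largest size of a set that it shatters. There are absolute constants $c, C>0$ such that for every integer $d\ge 4$ there exists a set $\mathcal H$ of hyperplanes in $\mathbb R^d$ with $$c\, d^2\log d\ \le\ \mathrm{VCdim}(\Delta(\mathcal H))\ \le\ C\, d^2\log d ,$$ that is, $\mathrm{VCdim}(\Delta(\mathcal H))=\Theta(d^2\log d)$. Moreover, the upper bound $\mathrm{VCdim}(\Delta(\mathcal H))\le C\,d^2\log d$ holds for every $d\ge 4$ and every set $\mathcal H$ of hyperplanes in $\mathbb R^d$. -/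

import Mathlib

/-- A set system `R` on the ground type `α` shatters `Y` if every subset of `Y` is of the form
`Y ∩ S` with `S ∈ R`. -/
def SetShatters {α : Type*} (R : Set (Set α)) (Y : Set α) : Prop :=
  ∀ Z : Set α, Z ⊆ Y → ∃ S ∈ R, Y ∩ S = Z

/-- The VC-dimension of a set system: the supremum, in `ℕ∞`, of the sizes of the shattered sets.
(A shattered set is contained in a member of the system, hence in the ground set.) -/
noncomputable def setVCDim {α : Type*} (R : Set (Set α)) : ℕ∞ :=
  ⨆ Y ∈ {Y : Set α | SetShatters R Y}, Y.encard

/-- Affine hyperplanes of `ℝ^d`. -/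
def IsAffineHyperplane {d : ℕ} (h : Set (EuclideanSpace ℝ (Fin d))) : Prop :=
  ∃ a : EuclideanSpace ℝ (Fin d), a ≠ 0 ∧ ∃ b : ℝ, h = {x | inner ℝ a x = b}

/-- The set system `Δ(H)` on a set `H` of hyperplanes in `ℝ^d`: its members are, for each open
`d`-dimensional simplex `s`, the set of those `h ∈ H` that meet `s`. -/
def simplexSystem {d : ℕ} (H : Set (Set (EuclideanSpace ℝ (Fin d)))) :
    Set (Set (Set (EuclideanSpace ℝ (Fin d)))) :=
  {S | ∃ s : Affine.Simplex ℝ (EuclideanSpace ℝ (Fin d)) d,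
    S = {h ∈ H | (h ∩ s.interior).Nonempty}}

/-! Upper bound: a hyperplane meets an open simplex exactly when it strictly separates two vertices.
Dually, hyperplanes are vectors `(a, b)` in dimension `d + 1` and each vertex is a linear
functional, so the trace of a simplex is (union of `d + 1` positive sides) ∩ (union of `d + 1`
negative sides). By Sauer–Shelah each side has at most `(m + 1) ^ (d + 1)` traces on `m`
hyperplanes; shattering forces `2 ^ m ≤ (m + 1) ^ (2 * (d + 1) ^ 2)`, hence `m = O(d² log d)`.

Lower bound, with all hyperplanes: if one vertex is the origin, `⟨a, x⟩ = 1` is met iff another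
vertex has value above `1`. So it suffices to find vectors all of whose subsets are cut out by
unions of `d` half-spaces. Point–rectangle incidence is such a sign pattern in `ℝ^5`, and `n * 2 ^
(n - 1)` rectangles can be hit in every pattern by `2 ^ n` points. With about `d / 5` orthogonal
blocks, one vertex encodes a point in every block at once, so all blocks share the same `d`
vertices. -/

/-! ### Upper bound. -/

/-- Sauer–Shelah for the sets cut out of a finite family of vectors by open linear half-spaces. -/
theorem card_le_of_positive_sets {ι V : Type*} [Fintype ι] [DecidableEq ι] [AddCommGroup V]
    [Module ℝ V] [Module.Finite ℝ V] (x : ι → V) (𝒜 : Finset (Finset ι))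
    (h𝒜 : ∀ A ∈ 𝒜, ∃ φ : V →ₗ[ℝ] ℝ, ∀ i, i ∈ A ↔ 0 < φ (x i)) :
    𝒜.card ≤ (Fintype.card ι + 1) ^ Module.finrank ℝ V := by
  have key : 𝒜.vcDim ≤ Module.finrank ℝ V := by
    refine Finset.sup_le fun s hs => ?_
    rw [Finset.mem_shatterer] at hs
    -- In a dependency `∑ g i • x i = 0` with some `g j > 0`, a `φ` positive exactly where `g` is
    -- positive makes every `g i * φ (x i)` nonnegative and the `j`-th one positive, yet they sum to
    -- zero.
    have hli : LinearIndependent ℝ (fun i : s => x i) := by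
      by_contra hdep
      rw [Fintype.not_linearIndependent_iff] at hdep
      obtain ⟨g, hg, j, hj⟩ := hdep
      wlog hpos : 0 < g j generalizing g
      · exact this (fun i => -g i) (by simp only [neg_smul, Finset.sum_neg_distrib, hg, neg_zero])
          (by simpa using hj)
          (by simpa using lt_of_le_of_ne (not_lt.mp hpos) hj)
      obtain ⟨A, hA, hAs⟩ := hs (t := (Finset.univ.filter fun i : s => 0 < g i).map
        (Function.Embedding.subtype _)) (by intro i; simp; tauto)
      obtain ⟨φ, hφ⟩ := h𝒜 A hA
      have hmem : ∀ i : s, 0 < φ (x i) ↔ 0 < g i := by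
        intro i
        rw [← hφ]
        have := congrArg (fun t => (i : ι) ∈ t) hAs
        simpa using this
      have h0 : ∑ i, g i * φ (x i) = 0 := by
        simpa using congrArg φ hg
      have hnn : ∀ i ∈ (Finset.univ : Finset s), 0 ≤ g i * φ (x i) := by
        intro i _
        by_cases hi : 0 < g i
        · exact (mul_pos hi ((hmem i).2 hi)).le
        · exact mul_nonneg_of_nonpos_of_nonpos (not_lt.mp hi)
            (not_lt.mp fun h => hi ((hmem i).1 h))
      have := (Finset.sum_eq_zero_iff_of_nonneg hnn).1 h0 j (Finset.mem_univ _)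
      exact (mul_pos hpos ((hmem j).2 hpos)).ne' this
    simpa using hli.fintype_card_le_finrank
  calc 𝒜.card ≤ 𝒜.shatterer.card := 𝒜.card_le_card_shatterer
    _ ≤ ∑ k ∈ Finset.Iic 𝒜.vcDim, (Fintype.card ι).choose k := Finset.card_shatterer_le_sum_vcDim
    _ ≤ ∑ k ∈ Finset.Iic (Module.finrank ℝ V), (Fintype.card ι).choose k :=
        Finset.sum_le_sum_of_subset (Finset.Iic_subset_Iic.2 key)
    _ ≤ ∑ k ∈ Finset.range (Module.finrank ℝ V + 1),
          Fintype.card ι ^ k * 1 ^ (Module.finrank ℝ V - k) * (Module.finrank ℝ V).choose k := by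
        rw [show Finset.Iic (Module.finrank ℝ V) = Finset.range (Module.finrank ℝ V + 1) by
          ext; simp]
        refine Finset.sum_le_sum fun k hk => ?_
        have h1 : 1 ≤ (Module.finrank ℝ V).choose k :=
          Nat.choose_pos (Nat.lt_succ_iff.1 (Finset.mem_range.1 hk))
        rw [one_pow, mul_one]
        exact (Nat.choose_le_pow _ _).trans (Nat.le_mul_of_pos_right _ h1)
    _ = (Fintype.card ι + 1) ^ Module.finrank ℝ V := (add_pow _ _ _).symm

/-- Positive weights of sum one averaging to zero values of both signs. -/
theorem exists_pos_weights_sum_mul_eq_zero {ι : Type*} [Fintype ι] (f : ι → ℝ)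
    (hpos : ∃ i, 0 < f i) (hneg : ∃ i, f i < 0) :
    ∃ w : ι → ℝ, (∀ i, 0 < w i) ∧ ∑ i, w i = 1 ∧ ∑ i, w i * f i = 0 := by
  classical
  have main : ∃ u : ι → ℝ, (∀ i, 0 < u i) ∧ ∑ i, u i * f i = 0 := by
    -- Start from unit weights and raise only the weight of an index whose value opposes the sign of
    -- the total.
    have aux : ∀ i : ι, f i ≠ 0 → 0 ≤ -(∑ k, f k) / f i →
        ∃ u : ι → ℝ, (∀ i, 0 < u i) ∧ ∑ i, u i * f i = 0 := by
      intro i hi hs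
      refine ⟨fun k => 1 + if k = i then -(∑ k, f k) / f i else 0, fun k => ?_, ?_⟩
      · dsimp only
        split_ifs <;> linarith
      · simp only [add_mul, one_mul, ite_mul, zero_mul, Finset.sum_add_distrib,
          Finset.sum_ite_eq', Finset.mem_univ, if_true]
        field_simp
        ring
    obtain ⟨i, hi⟩ := hpos
    obtain ⟨j, hj⟩ := hneg
    rcases le_total (∑ k, f k) 0 with hS | hS
    · exact aux i hi.ne' (div_nonneg (neg_nonneg.2 hS) hi.le)
    · exact aux j hj.ne (div_nonneg_of_nonpos (neg_nonpos.2 hS) hj.le)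
  obtain ⟨u, hu, hu0⟩ := main
  have hU : 0 < ∑ i, u i := Finset.sum_pos (fun i _ => hu i) ⟨hpos.choose, Finset.mem_univ _⟩
  refine ⟨fun i => u i / ∑ k, u k, fun i => div_pos (hu i) hU, ?_, ?_⟩
  · rw [← Finset.sum_div, div_self hU.ne']
  · simp_rw [div_mul_eq_mul_div]
    rw [← Finset.sum_div, hu0, zero_div]

/-- A hyperplane meets an open full-dimensional simplex iff it strictly separates two vertices. -/
theorem hyperplane_inter_simplex_interior_nonempty_iff {d : ℕ} (hd : 0 < d)
    (s : Affine.Simplex ℝ (EuclideanSpace ℝ (Fin d)) d) (a : EuclideanSpace ℝ (Fin d))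
    (ha : a ≠ 0) (b : ℝ) :
    ({x | inner ℝ a x = b} ∩ s.interior).Nonempty ↔
      (∃ i, b < inner ℝ a (s.points i)) ∧ ∃ i, inner ℝ a (s.points i) < b := by
  have hcomb : ∀ w : Fin (d + 1) → ℝ, ∑ i, w i = 1 →
      inner ℝ a (Finset.univ.affineCombination ℝ s.points w) - b =
        ∑ i, w i * (inner ℝ a (s.points i) - b) := by
    intro w hw
    rw [Finset.univ.affineCombination_eq_linear_combination _ _ hw, inner_sum]
    simp_rw [mul_sub, Finset.sum_sub_distrib, ← Finset.sum_mul, hw, one_mul, inner_smul_right]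
  constructor
  · rintro ⟨x, hx, w, hw, hw01, rfl⟩
    have h0 := hcomb w hw
    rw [show inner ℝ a _ = b from hx, sub_self] at h0
    -- The vertices affinely span the space, so a functional constant on them is constant,
    -- contradicting `a ≠ 0`.
    have hne : ¬ ∀ i, inner ℝ a (s.points i) = b := by
      intro hall
      have htop : affineSpan ℝ (Set.range s.points) = ⊤ :=
        s.independent.affineSpan_eq_top_iff_card_eq_finrank_add_one.2 (by simp)
      have hconst : ∀ y : EuclideanSpace ℝ (Fin d), inner ℝ a y = b := by
        intro y
        have hy : y ∈ affineSpan ℝ (Set.range s.points) := htop ▸ AffineSubspace.mem_top ℝ _ y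
        obtain ⟨w, hw, rfl⟩ := eq_affineCombination_of_mem_affineSpan_of_fintype hy
        have := hcomb w hw
        simp only [hall, sub_self, mul_zero, Finset.sum_const_zero] at this
        linarith
      have h1 := hconst 0
      have h2 := hconst a
      rw [inner_zero_right] at h1
      rw [← h1] at h2
      exact ha (inner_self_eq_zero.1 h2)
    constructor
    · by_contra! hle
      refine hne fun i => ?_
      have := (Finset.sum_eq_zero_iff_of_nonpos fun i _ =>
        mul_nonpos_of_nonneg_of_nonpos (hw01 i).1.le (sub_nonpos.2 (hle i))).1 h0.symm i
        (Finset.mem_univ _)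
      have := (mul_eq_zero.1 this).resolve_left (hw01 i).1.ne'
      linarith
    · by_contra! hle
      refine hne fun i => ?_
      have := (Finset.sum_eq_zero_iff_of_nonneg fun i _ =>
        mul_nonneg (hw01 i).1.le (sub_nonneg.2 (hle i))).1 h0.symm i (Finset.mem_univ _)
      have := (mul_eq_zero.1 this).resolve_left (hw01 i).1.ne'
      linarith
  · rintro ⟨⟨i, hi⟩, ⟨j, hj⟩⟩
    obtain ⟨w, hwpos, hw1, hw0⟩ := exists_pos_weights_sum_mul_eq_zero
      (fun i => inner ℝ a (s.points i) - b) ⟨i, sub_pos.2 hi⟩ ⟨j, sub_neg.2 hj⟩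
    refine ⟨Finset.univ.affineCombination ℝ s.points w, ?_, w, hw1, fun i => ⟨hwpos i, ?_⟩, rfl⟩
    · have := hcomb w hw1
      rw [hw0] at this
      exact sub_eq_zero.1 this
    -- The interior also asks for weights below `1`, which needs a second vertex.
    · have : Nontrivial (Fin (d + 1)) := Fin.nontrivial_iff_two_le.2 (by omega)
      obtain ⟨k, hk⟩ := exists_ne i
      rw [← hw1]
      exact Finset.single_lt_sum hk (Finset.mem_univ _) (Finset.mem_univ _) (hwpos k)
        fun k _ _ => (hwpos k).le

theorem SetShatters.mono {α : Type*} {R : Set (Set α)} {Y Y' : Set α} (h : SetShatters R Y)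
    (hY : Y' ⊆ Y) : SetShatters R Y' := by
  intro Z hZ
  obtain ⟨S, hS, rfl⟩ := h Z (hZ.trans hY)
  refine ⟨S, hS, ?_⟩
  ext y
  exact ⟨fun ⟨h1, h2⟩ => ⟨hY h1, h2⟩, fun h1 => ⟨hZ h1, h1.2⟩⟩

/-- A finite set of hyperplanes shattered by the open simplices satisfies the counting bound that
comes from choosing the positive and the negative side at each vertex. -/
theorem two_pow_card_le_of_setShatters_simplexSystem {d : ℕ} (hd : 0 < d)
    {H : Set (Set (EuclideanSpace ℝ (Fin d)))} (hH : ∀ h ∈ H, IsAffineHyperplane h)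
    (Y : Finset (Set (EuclideanSpace ℝ (Fin d)))) (hY : SetShatters (simplexSystem H) (Y : Set _)) :
    2 ^ Y.card ≤ (Y.card + 1) ^ (2 * (d + 1) ^ 2) := by
  classical
  have hYH : ∀ h ∈ Y, h ∈ H := by
    obtain ⟨S, ⟨s, rfl⟩, hS⟩ := hY Y subset_rfl
    exact fun h hh => (hS.symm.subset hh).2.1
  choose! a ha b hb using hH
  let x : Y → EuclideanSpace ℝ (Fin d) × ℝ := fun h => (a h, b h)
  let 𝒜 : Finset (Finset Y) := Finset.univ.filter fun A =>
    ∃ φ : EuclideanSpace ℝ (Fin d) × ℝ →ₗ[ℝ] ℝ, ∀ i, i ∈ A ↔ 0 < φ (x i)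
  have h𝒜 : 𝒜.card ≤ (Y.card + 1) ^ (d + 1) := by
    have := card_le_of_positive_sets x 𝒜 (fun A hA => (Finset.mem_filter.1 hA).2)
    simpa using this
  have hside : ∀ φ : EuclideanSpace ℝ (Fin d) × ℝ →ₗ[ℝ] ℝ,
      (Finset.univ.filter fun i => 0 < φ (x i)) ∈ 𝒜 := fun φ =>
    Finset.mem_filter.2 ⟨Finset.mem_univ _, φ, by simp⟩
  let ev : EuclideanSpace ℝ (Fin d) → (EuclideanSpace ℝ (Fin d) × ℝ →ₗ[ℝ] ℝ) := fun v =>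
    (innerₗ _ v) ∘ₗ LinearMap.fst ℝ _ _ - LinearMap.snd ℝ _ _
  have hev : ∀ v (h : Y), ev v (x h) = inner ℝ (a h) v - b h := by
    intro v h
    simp [ev, x, real_inner_comm]
  let F : (Fin (d + 1) → 𝒜) × (Fin (d + 1) → 𝒜) → Finset Y := fun p =>
    Finset.univ.filter fun h => (∃ i, h ∈ (p.1 i : Finset Y)) ∧ ∃ i, h ∈ (p.2 i : Finset Y)
  have hF : Function.Surjective F := by
    intro Z
    obtain ⟨S, ⟨s, rfl⟩, hS⟩ := hY (Subtype.val '' (Z : Set Y)) (by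
      rintro _ ⟨h, -, rfl⟩
      exact h.2)
    refine ⟨(fun i => ⟨_, hside (ev (s.points i))⟩, fun i => ⟨_, hside (-ev (s.points i))⟩), ?_⟩
    ext h
    have hh : h ∈ Z ↔ ((h : Set _) ∩ s.interior).Nonempty := by
      have := Set.ext_iff.1 hS h
      simp only [Set.mem_inter_iff, Finset.mem_coe, h.2, true_and, Set.mem_ofPred_eq,
        hYH _ h.2] at this
      rw [this]
      simp
    rw [hh]
    conv_rhs => rw [hb h (hYH _ h.2)]
    rw [hyperplane_inter_simplex_interior_nonempty_iff hd s _ (ha h (hYH _ h.2))]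
    simp [F, hev]
  have hcard := Fintype.card_le_of_surjective F hF
  simp only [Fintype.card_finset, Fintype.card_coe, Fintype.card_prod, Fintype.card_pi,
    Finset.prod_const, Finset.card_univ, Fintype.card_fin] at hcard
  calc 2 ^ Y.card ≤ 𝒜.card ^ (d + 1) * 𝒜.card ^ (d + 1) := hcard
    _ ≤ ((Y.card + 1) ^ (d + 1)) ^ (d + 1) * ((Y.card + 1) ^ (d + 1)) ^ (d + 1) := by gcongr
    _ = _ := by rw [← pow_mul, ← pow_add]; ring_nf

theorem le_sq_mul_log_of_two_pow_le {d m : ℕ} (hd : 4 ≤ d)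
    (h : 2 ^ m ≤ (m + 1) ^ (2 * (d + 1) ^ 2)) :
    (m : ℝ) ≤ 40 * ((d : ℝ) ^ 2 * Real.log d) := by
  have hd' : (4 : ℝ) ≤ d := by exact_mod_cast hd
  have hm1 : (0 : ℝ) < m + 1 := by positivity
  have hlog : (m : ℝ) * Real.log 2 ≤ 2 * (d + 1) ^ 2 * Real.log (m + 1) := by
    have h' : ((2 : ℝ) ^ m) ≤ ((m : ℝ) + 1) ^ (2 * (d + 1) ^ 2) := by exact_mod_cast h
    have := Real.log_le_log (by positivity) h'
    rw [Real.log_pow, Real.log_pow] at this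
    exact_mod_cast this
  have hlm : 0 ≤ Real.log ((m : ℝ) + 1) := Real.log_nonneg (by linarith [m.cast_nonneg (α := ℝ)])
  -- For `d ≥ 4`, `2 (d + 1)² ≤ 0.69 B` and `2 B ≤ d⁴`. The tangent to `log` at `2 B` then bounds `B
  -- * log (m + 1)` with only `m / 2` to absorb on the left.
  set B : ℝ := 5 * (d : ℝ) ^ 2 with hB
  have hBpos : 0 < B := by positivity
  have h1 : (m : ℝ) ≤ B * Real.log (m + 1) := by
    have h2 : (2 : ℝ) * (d + 1) ^ 2 ≤ 0.69 * B := by rw [hB]; nlinarith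
    have h3 := mul_le_mul_of_nonneg_right h2 hlm
    have h4 : (m : ℝ) * 0.69 ≤ m * Real.log 2 := by
      gcongr
      linarith [Real.log_two_gt_d9]
    linarith
  have h2 : Real.log (m + 1) ≤ (m + 1) / (2 * B) + Real.log (2 * B) - 1 := by
    have := Real.log_le_sub_one_of_pos (x := ((m : ℝ) + 1) / (2 * B)) (by positivity)
    rw [Real.log_div (by positivity) (by positivity)] at this
    linarith
  have h3 : B * Real.log (m + 1) ≤ (m + 1) / 2 + B * Real.log (2 * B) - B := by
    have := mul_le_mul_of_nonneg_left h2 hBpos.le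
    have e : B * ((m + 1) / (2 * B) + Real.log (2 * B) - 1) =
      (m + 1) / 2 + B * Real.log (2 * B) - B := by field_simp
    linarith
  have h4 : Real.log (2 * B) ≤ 4 * Real.log d := by
    have : 2 * B ≤ (d : ℝ) ^ 4 := by
      have h10 : (10 : ℝ) ≤ (d : ℝ) ^ 2 := by nlinarith
      have := mul_le_mul_of_nonneg_right h10 (sq_nonneg (d : ℝ))
      rw [hB]
      linarith
    have := Real.log_le_log (by positivity) this
    rwa [Real.log_pow, Nat.cast_ofNat] at this
  have h5 := mul_le_mul_of_nonneg_left h4 hBpos.le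
  have h6 : 1 ≤ B := by rw [hB]; nlinarith
  have h7 : 40 * ((d : ℝ) ^ 2 * Real.log d) = 2 * (B * (4 * Real.log d)) := by rw [hB]; ring
  linarith

/-- The upper bound on the VC-dimension for an arbitrary set of hyperplanes. -/
theorem setVCDim_simplexSystem_le {d : ℕ} (hd : 4 ≤ d)
    {H : Set (Set (EuclideanSpace ℝ (Fin d)))} (hH : ∀ h ∈ H, IsAffineHyperplane h) :
    ∃ n : ℕ, setVCDim (simplexSystem H) = (n : ℕ∞) ∧
      (n : ℝ) ≤ 40 * ((d : ℝ) ^ 2 * Real.log d) := by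
  set N : ℕ := ⌊40 * ((d : ℝ) ^ 2 * Real.log d)⌋₊ with hN
  have hnn : 0 ≤ 40 * ((d : ℝ) ^ 2 * Real.log d) := by
    have := Real.log_natCast_nonneg d
    positivity
  have hle : setVCDim (simplexSystem H) ≤ N := by
    refine iSup₂_le fun Y hY => ?_
    by_contra! hlt
    -- The shattered set may be infinite, so the count is applied to a subset of size `N + 1`.
    obtain ⟨T, hTY, hT⟩ := Set.exists_subset_encard_eq (Order.add_one_le_of_lt hlt)
    have hTfin : T.Finite := Set.finite_of_encard_eq_coe (k := N + 1) (by simpa using hT)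
    have hcard := le_sq_mul_log_of_two_pow_le hd
      (two_pow_card_le_of_setShatters_simplexSystem (by omega) hH hTfin.toFinset
        (by simpa using SetShatters.mono hY hTY))
    rw [hTfin.encard_eq_coe_toFinset_card] at hT
    have hT' : hTfin.toFinset.card = N + 1 := by exact_mod_cast hT
    have := Nat.le_floor hcard
    omega
  obtain ⟨n, hn⟩ := ENat.ne_top_iff_exists.1 (ne_top_of_le_ne_top (ENat.natCast_ne_top N) hle)
  refine ⟨n, hn.symm, ?_⟩
  rw [← hn] at hle
  exact (Nat.cast_le.2 (Nat.cast_le.1 hle)).trans (Nat.floor_le hnn)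

/-! ### Lower bound: reduction to unions of half-spaces. -/

open Filter Topology in
/-- Rows of a square matrix can be moved so as to become independent, keeping finitely many strict
sign conditions, and pushing the positive values beyond `1`. -/
theorem exists_isUnit_det_sign_dotProduct {d : ℕ} {ι : Type*} [Finite ι] (a : ι → Fin d → ℝ)
    (U : Matrix (Fin d) (Fin d) ℝ) :
    ∃ V : Matrix (Fin d) (Fin d) ℝ, IsUnit V ∧
      ∀ i k, (0 < U k ⬝ᵥ a i → 1 < V k ⬝ᵥ a i) ∧ (U k ⬝ᵥ a i < 0 → V k ⬝ᵥ a i < 0) := by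
  -- The perturbation is `U + ε I`, singular only at the finitely many roots of the characteristic
  -- polynomial of `-U`; `0` may be a root but `ε > 0` avoids it.
  have hdet : ∀ᶠ ε : ℝ in 𝓝[>] 0, IsUnit (Matrix.scalar (Fin d) ε - -U) := by
    have hne : (-U).charpoly ≠ 0 := (Matrix.charpoly_monic _).ne_zero
    have hfin : {ε : ℝ | (-U).charpoly.IsRoot ε}.Finite := Polynomial.finite_setOfPred_isRoot hne
    have : ∀ᶠ ε : ℝ in 𝓝[>] 0, ε ∉ {ε : ℝ | (-U).charpoly.IsRoot ε} \ {0} := by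
      refine nhdsWithin_le_nhds ?_
      exact hfin.sdiff.isClosed.isOpen_compl.mem_nhds (by simp)
    filter_upwards [this, self_mem_nhdsWithin] with ε h1 h2
    rw [Matrix.isUnit_iff_isUnit_det, isUnit_iff_ne_zero, ← Matrix.eval_charpoly]
    exact fun h => h1 ⟨h, ne_of_gt h2⟩
  have hcont : ∀ i k, Tendsto (fun ε : ℝ => (Matrix.scalar (Fin d) ε - -U) k ⬝ᵥ a i) (𝓝[>] 0)
      (𝓝 (U k ⬝ᵥ a i)) := by
    intro i k
    refine tendsto_nhdsWithin_of_tendsto_nhds ?_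
    have hc : Continuous (fun ε : ℝ => (Matrix.scalar (Fin d) ε - -U) k ⬝ᵥ a i) := by
      unfold dotProduct
      refine continuous_finsetSum _ fun j _ => ?_
      simp only [Matrix.sub_apply, Matrix.neg_apply, Matrix.scalar_apply, Matrix.diagonal_apply]
      by_cases h : k = j <;> simp only [h, if_true, if_false] <;> fun_prop
    simpa using hc.tendsto 0
  have hsign : ∀ᶠ ε : ℝ in 𝓝[>] 0, ∀ i k,
      (0 < U k ⬝ᵥ a i → 0 < (Matrix.scalar (Fin d) ε - -U) k ⬝ᵥ a i) ∧
      (U k ⬝ᵥ a i < 0 → (Matrix.scalar (Fin d) ε - -U) k ⬝ᵥ a i < 0) := by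
    rw [eventually_all]; intro i
    rw [eventually_all]; intro k
    refine Filter.Eventually.and ?_ ?_
    · by_cases h : 0 < U k ⬝ᵥ a i
      · filter_upwards [(hcont i k).eventually_const_lt h] with ε hε _ using hε
      · exact Eventually.of_forall fun _ h' => absurd h' h
    · by_cases h : U k ⬝ᵥ a i < 0
      · filter_upwards [(hcont i k).eventually_lt_const h] with ε hε _ using hε
      · exact Eventually.of_forall fun _ h' => absurd h' h
  obtain ⟨ε, hW, hs⟩ := (hdet.and hsign).exists
  set W := Matrix.scalar (Fin d) ε - -U
  have hscale : ∀ᶠ r : ℝ in atTop, ∀ i k, 0 < W k ⬝ᵥ a i → 1 < r * (W k ⬝ᵥ a i) := by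
    rw [eventually_all]; intro i
    rw [eventually_all]; intro k
    by_cases h : 0 < W k ⬝ᵥ a i
    · filter_upwards [(tendsto_id.atTop_mul_const h).eventually_gt_atTop 1] with r hr _ using hr
    · exact Eventually.of_forall fun _ h' => absurd h' h
  obtain ⟨r, hr, hr0⟩ := (hscale.and (eventually_gt_atTop 0)).exists
  refine ⟨r • W, ?_, fun i k => ⟨fun h => ?_, fun h => ?_⟩⟩
  · exact hW.smul (Units.mk0 r hr0.ne')
  · change 1 < (r • W k) ⬝ᵥ a i
    rw [smul_dotProduct]
    exact hr i k ((hs i k).1 h)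
  · change (r • W k) ⬝ᵥ a i < 0
    rw [smul_dotProduct]
    exact mul_neg_of_pos_of_neg hr0 ((hs i k).2 h)

/-- The simplex spanned by the origin and the rows of an invertible matrix. -/
theorem exists_simplex_of_isUnit {d : ℕ} {V : Matrix (Fin d) (Fin d) ℝ} (hV : IsUnit V) :
    ∃ s : Affine.Simplex ℝ (EuclideanSpace ℝ (Fin d)) d,
      s.points 0 = 0 ∧ ∀ k, s.points (Fin.succ k) = WithLp.toLp 2 (V k) := by
  have hli : LinearIndependent ℝ (fun k => WithLp.toLp 2 (V k) : Fin d → EuclideanSpace ℝ (Fin d)) :=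
    (Matrix.linearIndependent_rows_iff_isUnit.2 hV).map'
      (WithLp.linearEquiv 2 ℝ (Fin d → ℝ)).symm.toLinearMap (LinearEquiv.ker _)
  refine ⟨⟨Fin.cons 0 fun k => WithLp.toLp 2 (V k), ?_⟩, rfl, fun k => rfl⟩
  rw [affineIndependent_iff_linearIndependent_vsub ℝ _ (0 : Fin (d + 1)),
    ← linearIndependent_equiv (finSuccAboveEquiv 0)]
  have hrow : ((fun i : {i : Fin (d + 1) // i ≠ 0} =>
      (Fin.cons 0 fun k => WithLp.toLp 2 (V k) : Fin (d + 1) → EuclideanSpace ℝ (Fin d)) i -ᵥ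
        (Fin.cons 0 fun k => WithLp.toLp 2 (V k) : Fin (d + 1) → EuclideanSpace ℝ (Fin d)) 0) ∘
      finSuccAboveEquiv 0) = fun k => WithLp.toLp 2 (V k) := by
    ext1 k
    simp [finSuccAboveEquiv_apply]
  rw [hrow]
  exact hli

/-- If every subset of a finite family of vectors of `ℝ^d` is cut out, with strict signs, by a union
of `d` linear half-spaces, then the dual family of hyperplanes is shattered by the simplices. -/
theorem natCard_le_setVCDim_simplexSystem {d : ℕ} (hd : 0 < d) {ι : Type*} [Finite ι]
    (a : ι → Fin d → ℝ)
    (h : ∀ S : Set ι, ∃ U : Matrix (Fin d) (Fin d) ℝ, ∀ i,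
      (i ∈ S → ∃ k, 0 < U k ⬝ᵥ a i) ∧ (i ∉ S → ∀ k, U k ⬝ᵥ a i < 0)) :
    (Nat.card ι : ℕ∞) ≤
      setVCDim (simplexSystem {h : Set (EuclideanSpace ℝ (Fin d)) | IsAffineHyperplane h}) := by
  have ha : ∀ i, WithLp.toLp 2 (a i) ≠ 0 := by
    intro i hi
    have hi' : a i = 0 := by simpa using hi
    obtain ⟨U, hU⟩ := h ∅
    simpa [hi'] using (hU i).2 (Set.notMem_empty _) ⟨0, hd⟩
  let f : ι → Set (EuclideanSpace ℝ (Fin d)) := fun i => {x | inner ℝ (WithLp.toLp 2 (a i)) x = 1}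
  have hcut : ∀ S : Set ι, ∃ s : Affine.Simplex ℝ (EuclideanSpace ℝ (Fin d)) d,
      ∀ i, (f i ∩ s.interior).Nonempty ↔ i ∈ S := by
    intro S
    obtain ⟨U, hU⟩ := h S
    obtain ⟨V, hV, hVU⟩ := exists_isUnit_det_sign_dotProduct a U
    obtain ⟨s, hs0, hs⟩ := exists_simplex_of_isUnit hV
    refine ⟨s, fun i => ?_⟩
    have hval : ∀ k, inner ℝ (WithLp.toLp 2 (a i)) (s.points (Fin.succ k)) = V k ⬝ᵥ a i := by
      intro k
      rw [hs, EuclideanSpace.inner_toLp_toLp]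
      simp
    rw [hyperplane_inter_simplex_interior_nonempty_iff hd s _ (ha i)]
    constructor
    · rintro ⟨⟨k, hk⟩, -⟩
      by_contra hi
      revert hk
      refine Fin.cases ?_ (fun k => ?_) k
      · rw [hs0, inner_zero_right]
        norm_num
      · rw [hval]
        have := (hVU i k).2 ((hU i).2 hi k)
        intro h'
        linarith
    · intro hi
      obtain ⟨k, hk⟩ := (hU i).1 hi
      refine ⟨⟨Fin.succ k, ?_⟩, 0, ?_⟩
      · rw [hval]
        exact (hVU i k).1 hk
      · rw [hs0, inner_zero_right]
        norm_num
  have hinj : Function.Injective f := by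
    intro i j hij
    obtain ⟨s, hs⟩ := hcut {i}
    have h1 := (hs i).2 rfl
    rw [hij, hs j] at h1
    exact h1.symm
  have hsh : SetShatters (simplexSystem {h | IsAffineHyperplane h}) (Set.range f) := by
    intro Z hZ
    obtain ⟨s, hs⟩ := hcut (f ⁻¹' Z)
    refine ⟨_, ⟨s, rfl⟩, ?_⟩
    ext y
    constructor
    · rintro ⟨⟨i, rfl⟩, -, hi⟩
      exact (hs i).1 hi
    · intro hy
      obtain ⟨i, rfl⟩ := hZ hy
      exact ⟨⟨i, rfl⟩, ⟨_, ha i, 1, rfl⟩, (hs i).2 hy⟩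
  have hcard : (Set.range f).encard = (Nat.card ι : ℕ∞) := by
    rw [← Set.image_univ, hinj.encard_image, Set.encard_univ, ENat.card_eq_coe_natCard]
  rw [← hcard]
  exact le_iSup₂_of_le (Set.range f) hsh le_rfl

/-! ### Lower bound: rectangles and orthogonal blocks. -/

/-- There are `n * 2 ^ (n - 1)` axis-parallel integer rectangles such that every subfamily is the
family of rectangles hit by the graph of some map defined on the `2 ^ n` columns. A rectangle
`r` consists of the points `(p, q)` with `r 0 ≤ p ≤ r 1` and `r 2 ≤ q ≤ r 3`. -/
theorem exists_rectangles_hit_by_graphs (n : ℕ) :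
    ∃ (ι : Type) (_ : Fintype ι) (r : ι → Fin 4 → ℕ), 2 * Fintype.card ι = n * 2 ^ n ∧
      (∀ i, r i 1 < 2 ^ n) ∧
      ∀ S : Set ι, ∃ y : ℕ → ℕ, (∀ q < 2 ^ n, ∃ p < 2 ^ n, y p = q) ∧
        ∀ i, i ∈ S ↔ ∃ p < 2 ^ n, (r i 0 ≤ p ∧ p ≤ r i 1) ∧ r i 2 ≤ y p ∧ y p ≤ r i 3 := by
  classical
  induction n with
  | zero =>
    exact ⟨Empty, inferInstance, Empty.elim, by simp, by simp, fun S =>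
      ⟨id, fun q hq => ⟨q, hq, rfl⟩, fun i => i.elim⟩⟩
  | succ n ih =>
    obtain ⟨ι, _, r, hcard, hr, h⟩ := ih
    -- Two copies of the family sit side by side, with each row split in two. Copied rectangles are
    -- unions of row pairs, so they ignore the choice within a pair; the new rectangles are the odd
    -- rows over the left half.
    refine ⟨(ι ⊕ ι) ⊕ Fin (2 ^ n), inferInstance,
      Sum.elim (Sum.elim (fun i => ![r i 0, r i 1, 2 * r i 2, 2 * r i 3 + 1])
        (fun i => ![r i 0 + 2 ^ n, r i 1 + 2 ^ n, 2 * r i 2, 2 * r i 3 + 1]))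
        (fun j => ![0, 2 ^ n - 1, 2 * j + 1, 2 * j + 1]), ?_, ?_, fun S => ?_⟩
    · simp only [Fintype.card_sum, Fintype.card_fin, pow_succ]
      linarith
    · have hpos : 0 < 2 ^ n := by positivity
      rintro ((i | i) | j)
      · have := hr i
        simp [pow_succ]
        omega
      · have := hr i
        simp [pow_succ]
        omega
      · simp [pow_succ]
        omega
    obtain ⟨y₁, hy₁, h₁⟩ := h {i | Sum.inl (Sum.inl i) ∈ S}
    obtain ⟨y₂, hy₂, h₂⟩ := h {i | Sum.inl (Sum.inr i) ∈ S}
    -- In row pair `j`, the left graph takes the odd row iff the new rectangle `j` is wanted; the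
    -- right graph takes the other row, which keeps all rows attained.
    let b : ℕ → ℕ := fun j => if ∃ hj : j < 2 ^ n, Sum.inr ⟨j, hj⟩ ∈ S then 1 else 0
    have hb : ∀ j, b j ≤ 1 := by
      intro j
      simp only [b]
      split_ifs <;> simp
    let y : ℕ → ℕ := fun p =>
      if p < 2 ^ n then 2 * y₁ p + b (y₁ p) else 2 * y₂ (p - 2 ^ n) + (1 - b (y₂ (p - 2 ^ n)))
    have hyl : ∀ p < 2 ^ n, y p = 2 * y₁ p + b (y₁ p) := fun p hp => if_pos hp
    have hyr : ∀ p, y (p + 2 ^ n) = 2 * y₂ p + (1 - b (y₂ p)) := by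
      intro p
      simp [y]
    refine ⟨y, fun q hq => ?_, ?_⟩
    · rw [pow_succ] at hq
      by_cases hqb : q % 2 = b (q / 2)
      · obtain ⟨p, hp, hpq⟩ := hy₁ (q / 2) (by omega)
        refine ⟨p, by rw [pow_succ]; omega, ?_⟩
        rw [hyl p hp, hpq]
        omega
      · obtain ⟨p, hp, hpq⟩ := hy₂ (q / 2) (by omega)
        refine ⟨p + 2 ^ n, by rw [pow_succ]; omega, ?_⟩
        rw [hyr, hpq]
        have := hb (q / 2)
        omega
    · rintro ((i | i) | j)
      · rw [show Sum.inl (Sum.inl i) ∈ S ↔ _ from h₁ i]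
        simp only [Sum.elim_inl, Matrix.cons_val]
        constructor
        · rintro ⟨p, hp, hx, hy⟩
          have := hb (y₁ p)
          refine ⟨p, by rw [pow_succ]; omega, hx, ?_⟩
          rw [hyl p hp]
          omega
        · rintro ⟨p, -, hx, hy⟩
          have hp : p < 2 ^ n := hx.2.trans_lt (hr i)
          have := hb (y₁ p)
          rw [hyl p hp] at hy
          exact ⟨p, hp, hx, by omega⟩
      · rw [show Sum.inl (Sum.inr i) ∈ S ↔ _ from h₂ i]
        simp only [Sum.elim_inl, Sum.elim_inr, Matrix.cons_val]
        constructor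
        · rintro ⟨p, hp, hx, hy⟩
          have := hb (y₂ p)
          refine ⟨p + 2 ^ n, by rw [pow_succ]; omega, by omega, ?_⟩
          rw [hyr p]
          omega
        · rintro ⟨p, hp', hx, hy⟩
          obtain ⟨p, rfl⟩ : ∃ p', p = p' + 2 ^ n := ⟨p - 2 ^ n, by omega⟩
          have := hb (y₂ p)
          rw [hyr p] at hy
          exact ⟨p, by rw [pow_succ] at hp'; omega, by omega, by omega⟩
      · have hbj : Sum.inr j ∈ S ↔ b j = 1 := by
          simp [b]
        have hpos : 0 < 2 ^ n := by positivity
        rw [hbj]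
        simp only [Sum.elim_inr, Matrix.cons_val]
        constructor
        · intro hj
          obtain ⟨p, hp, hpj⟩ := hy₁ j j.2
          refine ⟨p, by rw [pow_succ]; omega, by omega, ?_⟩
          rw [hyl p hp, hpj]
          omega
        · rintro ⟨p, -, hx, hy⟩
          have hp : p < 2 ^ n := by omega
          have := hb (y₁ p)
          rw [hyl p hp] at hy
          have hj : y₁ p = j := by omega
          rw [hj] at hy
          omega

/-- Membership of integer points in integer rectangles is the sign of an inner product in `ℝ^5`. -/
theorem exists_rectangle_sign_realization :
    ∃ (u : ℕ → ℕ → Fin 5 → ℝ) (a : (Fin 4 → ℕ) → Fin 5 → ℝ), ∀ p q r,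
      (((r 0 ≤ p ∧ p ≤ r 1) ∧ r 2 ≤ q ∧ q ≤ r 3) → 0 < u p q ⬝ᵥ a r) ∧
      (¬((r 0 ≤ p ∧ p ≤ r 1) ∧ r 2 ≤ q ∧ q ≤ r 3) → u p q ⬝ᵥ a r < 0) := by
  -- The product is `5` minus four powers of `8`, one per inequality: each is at most `1` if it
  -- holds and at least `8` if it fails.
  refine ⟨fun p q => ![5, -(8 ^ p)⁻¹, -8 ^ p, -(8 ^ q)⁻¹, -8 ^ q],
    fun r => ![1, 8 ^ r 0, (8 ^ r 1)⁻¹, 8 ^ r 2, (8 ^ r 3)⁻¹], fun p q r => ?_⟩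
  have hle : ∀ m k : ℕ, m ≤ k → ((8 : ℝ) ^ k)⁻¹ * 8 ^ m ≤ 1 := by
    intro m k hmk
    rw [inv_mul_le_one₀ (by positivity)]
    exact pow_le_pow_right₀ (by norm_num) hmk
  have hgt : ∀ m k : ℕ, k < m → 8 ≤ ((8 : ℝ) ^ k)⁻¹ * 8 ^ m := by
    intro m k hmk
    rw [le_inv_mul_iff₀ (by positivity), ← pow_succ]
    exact pow_le_pow_right₀ (by norm_num) hmk
  have hpos : ∀ m k : ℕ, 0 < ((8 : ℝ) ^ k)⁻¹ * 8 ^ m := fun m k => by positivity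
  have hval : ![(5 : ℝ), -(8 ^ p)⁻¹, -8 ^ p, -(8 ^ q)⁻¹, -8 ^ q] ⬝ᵥ
      ![1, 8 ^ r 0, (8 ^ r 1)⁻¹, 8 ^ r 2, (8 ^ r 3)⁻¹] =
      5 - (8 ^ p)⁻¹ * 8 ^ r 0 - (8 ^ r 1)⁻¹ * 8 ^ p - (8 ^ q)⁻¹ * 8 ^ r 2
        - (8 ^ r 3)⁻¹ * 8 ^ q := by
    simp only [dotProduct, Fin.sum_univ_five, Matrix.cons_val]
    ring
  rw [hval]
  constructor
  · rintro ⟨⟨h0, h1⟩, h2, h3⟩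
    linarith [hle _ _ h0, hle _ _ h1, hle _ _ h2, hle _ _ h3]
  · intro h
    have p0 := hpos (r 0) p
    have p1 := hpos p (r 1)
    have p2 := hpos (r 2) q
    have p3 := hpos q (r 3)
    by_cases h0 : r 0 ≤ p
    · by_cases h1 : p ≤ r 1
      · by_cases h2 : r 2 ≤ q
        · have := hgt q (r 3) (not_le.1 fun h3 => h ⟨⟨h0, h1⟩, h2, h3⟩)
          linarith
        · linarith [hgt _ _ (not_le.1 h2)]
      · linarith [hgt _ _ (not_le.1 h1)]
    · linarith [hgt _ _ (not_le.1 h0)]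

/-- Placing a copy of the rectangle construction into each of `m` orthogonal blocks. -/
theorem block_le_setVCDim_simplexSystem {d m n : ℕ} (hd : 0 < d) (hm : m * 5 ≤ d)
    (hn : 2 ^ n ≤ d) :
    ∃ N : ℕ, 2 * N = m * (n * 2 ^ n) ∧ (N : ℕ∞) ≤
      setVCDim (simplexSystem {h : Set (EuclideanSpace ℝ (Fin d)) | IsAffineHyperplane h}) := by
  obtain ⟨ι, _, r, hcard, -, h⟩ := exists_rectangles_hit_by_graphs n
  obtain ⟨u, a, hua⟩ := exists_rectangle_sign_realization
  let e : Fin m × Fin 5 → Fin d := fun x => Fin.castLE hm (finProdFinEquiv x)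
  have he : Function.Injective e := (Fin.castLE_injective hm).comp finProdFinEquiv.injective
  have hdot : ∀ (g : Fin m × Fin 5 → ℝ) (j : Fin m) (c : Fin 5 → ℝ),
      Function.extend e g 0 ⬝ᵥ
        Function.extend e (fun x : Fin m × Fin 5 => if x.1 = j then c x.2 else 0) 0 =
      (fun t => g (j, t)) ⬝ᵥ c := by
    intro g j c
    unfold dotProduct
    rw [← Finset.sum_subset (Finset.subset_univ (Finset.univ.map ⟨e, he⟩))
      (fun t _ ht => by
        rw [Function.extend_apply' _ _ _ (by simpa using ht), Pi.zero_apply, zero_mul]),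
      Finset.sum_map, Fintype.sum_prod_type]
    simp [he.extend_apply, Finset.sum_ite_irrel]
  refine ⟨Nat.card (Fin m × ι), ?_, natCard_le_setVCDim_simplexSystem hd
    (fun x : Fin m × ι =>
      Function.extend e (fun z : Fin m × Fin 5 => if z.1 = x.1 then a (r x.2) z.2 else 0) 0)
    fun S => ?_⟩
  · rw [Nat.card_eq_fintype_card, Fintype.card_prod, Fintype.card_fin, ← hcard]
    ring
  choose y hy₁ hy using fun j : Fin m => h {i | (j, i) ∈ S}
  have hpos : 0 < 2 ^ n := by positivity
  -- Vertex `k` carries, in block `j`, the graph point over column `k % 2 ^ n`. Surplus vertices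
  -- repeat columns and so hit nothing new.
  refine ⟨fun k => Function.extend e
    (fun z => u (k % 2 ^ n) (y z.1 (k % 2 ^ n)) z.2) 0, ?_⟩
  rintro ⟨j, i⟩
  simp only [hdot]
  constructor
  · intro hji
    obtain ⟨p, hp, hin⟩ := (hy j i).1 hji
    refine ⟨⟨p, hp.trans_le hn⟩, (hua _ _ _).1 ?_⟩
    simpa only [Nat.mod_eq_of_lt hp] using hin
  · intro hji k
    refine (hua _ _ _).2 fun hin => hji ((hy j i).2 ⟨_, Nat.mod_lt _ hpos, hin⟩)

/-! ### Lower bound: constants. -/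

theorem one_le_setVCDim_simplexSystem {d : ℕ} (hd : 0 < d) :
    (1 : ℕ∞) ≤
      setVCDim (simplexSystem {h : Set (EuclideanSpace ℝ (Fin d)) | IsAffineHyperplane h}) := by
  classical
  have := natCard_le_setVCDim_simplexSystem (ι := Unit) hd (fun _ => Pi.single ⟨0, hd⟩ 1)
    fun S => ⟨fun _ => Pi.single ⟨0, hd⟩ (if () ∈ S then 1 else -1), fun i => by
      constructor
      · exact fun h => ⟨⟨0, hd⟩, by simp [show () ∈ S from h]⟩
      · exact fun h k => by simp [show () ∉ S from h]⟩
  simpa using this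

theorem le_setVCDim_simplexSystem {d n : ℕ} (hd : 4 ≤ d)
    (hn : setVCDim (simplexSystem {h : Set (EuclideanSpace ℝ (Fin d)) | IsAffineHyperplane h}) =
      (n : ℕ∞)) :
    (1 / 100 : ℝ) * ((d : ℝ) ^ 2 * Real.log d) ≤ n := by
  -- At `d = 4` there is no block of dimension `5`, but the claimed bound is below `1`.
  rcases eq_or_lt_of_le hd with rfl | hd5
  · have h1 : (1 : ℝ) ≤ n := by
      have := one_le_setVCDim_simplexSystem (d := 4) (by norm_num)
      rw [hn] at this
      exact_mod_cast this
    have h4 : Real.log ((4 : ℕ) : ℝ) = 2 * Real.log 2 := by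
      rw [show ((4 : ℕ) : ℝ) = 2 ^ 2 by norm_num, Real.log_pow]
      norm_num
    rw [h4]
    have := Real.log_two_lt_d9
    norm_num
    linarith
  · set k := Nat.log 2 d with hk
    obtain ⟨N, hN, hle⟩ := block_le_setVCDim_simplexSystem (d := d) (m := d / 5) (n := k) (by omega)
      (by omega) (Nat.pow_log_le_self 2 (by omega))
    rw [hn] at hle
    have hNn : (N : ℝ) ≤ n := by exact_mod_cast hle
    have hk2 : 2 ≤ k := Nat.le_log_of_pow_le (by norm_num) (by omega)
    have hlt : d < 2 ^ (k + 1) := Nat.lt_pow_succ_log_self (by norm_num) d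
    -- The worst case is `d = 9`, where `d / 5 = 1`.
    have hm : (d : ℝ) ≤ 9 * (d / 5 : ℕ) := by
      have : d ≤ 9 * (d / 5) := by omega
      exact_mod_cast this
    have hp : (d : ℝ) ≤ 2 * 2 ^ k := by
      rw [pow_succ'] at hlt
      exact_mod_cast hlt.le
    have hlog : Real.log d ≤ (3 / 2) * 0.7 * k := by
      have h1 : Real.log d ≤ (k + 1 : ℕ) * Real.log 2 := by
        rw [← Real.log_pow]
        exact Real.log_le_log (by positivity) (by exact_mod_cast hlt.le)
      have h2 : ((k + 1 : ℕ) : ℝ) ≤ 3 / 2 * k := by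
        have : (2 : ℝ) ≤ k := by exact_mod_cast hk2
        push_cast
        linarith
      have h3 := Real.log_two_lt_d9
      calc Real.log d ≤ (k + 1 : ℕ) * Real.log 2 := h1
        _ ≤ (3 / 2 * k) * 0.7 := by
          gcongr
          linarith
        _ = _ := by ring
    have hN' : (2 : ℝ) * N = (d / 5 : ℕ) * (k * 2 ^ k) := by exact_mod_cast hN
    have hlog0 := Real.log_natCast_nonneg d
    calc (1 / 100 : ℝ) * ((d : ℝ) ^ 2 * Real.log d)
        = 1 / 100 * (d * (Real.log d * d)) := by ring
      _ ≤ 1 / 100 * (9 * (d / 5 : ℕ) * ((3 / 2) * 0.7 * k * (2 * 2 ^ k))) := by gcongr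
      _ = 0.378 * N := by linear_combination 0.189 * -hN'
      _ ≤ n := by linarith [N.cast_nonneg (α := ℝ)]

theorem theorem2 :
    ∃ c C : ℝ, 0 < c ∧ 0 < C ∧ ∀ d : ℕ, 4 ≤ d →
      (∃ H : Set (Set (EuclideanSpace ℝ (Fin d))), (∀ h ∈ H, IsAffineHyperplane h) ∧
        ∃ n : ℕ, setVCDim (simplexSystem H) = (n : ℕ∞) ∧
          c * ((d : ℝ) ^ 2 * Real.log d) ≤ (n : ℝ) ∧
          (n : ℝ) ≤ C * ((d : ℝ) ^ 2 * Real.log d)) ∧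
      (∀ H : Set (Set (EuclideanSpace ℝ (Fin d))), (∀ h ∈ H, IsAffineHyperplane h) →
        ∃ n : ℕ, setVCDim (simplexSystem H) = (n : ℕ∞) ∧
          (n : ℝ) ≤ C * ((d : ℝ) ^ 2 * Real.log d)) := by
  refine ⟨1 / 100, 40, by norm_num, by norm_num, fun d hd =>
    ⟨⟨{h | IsAffineHyperplane h}, fun _ h => h, ?_⟩, fun H hH => setVCDim_simplexSystem_le hd hH⟩⟩
  obtain ⟨n, hn, hle⟩ := setVCDim_simplexSystem_le (d := d) hd
    (H := {h | IsAffineHyperplane h}) fun _ h => h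
  exact ⟨n, hn, le_setVCDim_simplexSystem hd hn, hle⟩
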